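/- Consider $N\ge 1$ parties $X^{(1)},\dots,X^{(N)}$, where $X^{(i)}$ has an input space $X^{(i)}_I$ and an output space $X^{(i)}_O$ of finite dimensions $d_{X^{(i)}_I},d_{X^{(i)}_O}\ge 1$. For a matrix $W$ on $\bigotimes_{i}(X^{(i)}_I\otimes X^{(i)}_O)$ and a set $S$ of these spaces, write ${}_SW=\frac{\mathbb 1_S}{d_S}\otimes\operatorname{tr}_SW$. * $W$ is a *process* ($W\in\mathtt{Proc}$) if $W\ge 0$ and $\operatorname{tr}[W^{\mathrm T}(M_1\otimes\cdots\otimes M_N)]=1$ for all Choi matrices $M_i$ of CPTP maps from $X^{(i)}_I$ to $X^{(i)}_O$, i.e. $M_i\ge 0$ with $\operatorname{tr}_{X^{(i)}_O}M_i=\mathbb 1_{X^{(i)}_I}$. * $W$ is *free* ($W\in\mathtt{Free}$) if $W=\rho\otimes\mathbb 1$ with $\rho$ a quantum state on the tensor product of all input spaces and $\mathbb 1$ the identity on all output spaces. * $W$ is *causally ordered* with order $X^{(1)}\prec\cdots\prec X^{(N)}$ if $W\ge 0$, $\operatorname{tr}W=\prod_{i=1}^N d_{X^{(i)}_O}$,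 and for every $k=1,\dots,N$, ${}_{L_k}W={}_{L_kX^{(k)}_O}W$, where $L_k$ is the set of all input and output spaces of $X^{(k+1)},\dots,X^{(N)}$ (for $k=N$: $W={}_{X^{(N)}_O}W$). * $W$ has $X^{(N)}$ as *definite last party* if $W\in\mathtt{Proc}$ and ${}_{X^{(N)}_O}W=W$. * The *signalling robustness* is $\mathcal R_s(W)=\min\{s\ge 0 : \exists\,T\in\mathtt{Proc},\ \frac{W+sT}{1+s}\in\mathtt{Free}\}$. **Proposition.** If $W$ is causally ordered with order $X^{(1)}\prec\cdots\prec X^{(N)}$, or, more generally, if $W$ is any process with $X^{(N)}$ as definite last party, then the minimum defining $\mathcal R_s(W)$ exists and $$\mathcal R_s(W)\le\prod_{i=1}^{N-1}d_{X^{(i)}_O}^2-1 .$$ -/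

import Mathlib

open scoped ComplexOrder

noncomputable section

namespace ProcMat

/-- The legs (elementary systems) of an `N`-party process: `Sum.inl i` is the input leg `X^(i)_I`
of party `i`, `Sum.inr i` is its output leg `X^(i)_O`. -/
abbrev Leg (N : ℕ) := Fin N ⊕ Fin N

/-- The input leg of party `i` (what party `i` receives). -/
abbrev inp {N : ℕ} (i : Fin N) : Leg N := Sum.inl i

/-- The output leg of party `i` (what party `i` sends forward). -/
abbrev out {N : ℕ} (i : Fin N) : Leg N := Sum.inr i

/-- The party to which a leg belongs. -/
def party {N : ℕ} (l : Leg N) : Fin N := Sum.elim id id l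

/-- The product basis of `⨂ l, ℂ ^ (d l)`. -/
abbrev Idx {ι : Type} (d : ι → ℕ) := (l : ι) → Fin (d l)

/-- Operators on `⨂ l, ℂ ^ (d l)`, as matrices in the product basis. -/
abbrev Op {ι : Type} (d : ι → ℕ) := Matrix (Idx d) (Idx d) ℂ

/-- Replace the coordinates of `x` in `S` by those of `z`. -/
def overwrite {ι : Type} [DecidableEq ι] {d : ι → ℕ} (S : Finset ι)
    (z : (l : {l // l ∈ S}) → Fin (d l)) (x : Idx d) : Idx d :=
  fun l => if h : l ∈ S then z ⟨l, h⟩ else x l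

/-- The operation `_S W = (𝟙_S / d_S) ⊗ tr_S W`: trace out the legs in `S` and replace them by the
maximally mixed state. -/
def depolarize {ι : Type} [DecidableEq ι] {d : ι → ℕ} (S : Finset ι) (W : Op d) : Op d :=
  Matrix.of fun x y =>
    if ∀ l ∈ S, x l = y l then
      (∏ l ∈ S, (d l : ℂ))⁻¹ *
        ∑ z : ((l : {l // l ∈ S}) → Fin (d l)), W (overwrite S z x) (overwrite S z y)
    else 0

/-- `M` is the Choi matrix of a CPTP map from `ℂ ^ a` to `ℂ ^ b`: `M ≥ 0` and `tr_b M = 𝟙_a`. -/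
structure IsChannel {a b : ℕ} (M : Matrix (Fin a × Fin b) (Fin a × Fin b) ℂ) : Prop where
  posSemidef : M.PosSemidef
  tracePreserving : ∀ k k' : Fin a,
    ∑ m : Fin b, M (k, m) (k', m) = (1 : Matrix (Fin a) (Fin a) ℂ) k k'

/-- The tensor product `M_1 ⊗ ⋯ ⊗ M_N` of local operators, `M_i` acting on the two legs of
party `i`. -/
def localOp {N : ℕ} {d : Leg N → ℕ}
    (M : (i : Fin N) →
      Matrix (Fin (d (inp i)) × Fin (d (out i))) (Fin (d (inp i)) × Fin (d (out i))) ℂ) :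
    Op d :=
  Matrix.of fun x y => ∏ i, M i (x (inp i), x (out i)) (y (inp i), y (out i))

/-- The set `Proc` of proper process matrices: `W ≥ 0` and `tr[Wᵀ (M_1 ⊗ ⋯ ⊗ M_N)] = 1` for all
Choi matrices `M_i` of CPTP maps of the parties. -/
structure IsProcess {N : ℕ} {d : Leg N → ℕ} (W : Op d) : Prop where
  posSemidef : W.PosSemidef
  normalized : ∀ M : (i : Fin N) →
      Matrix (Fin (d (inp i)) × Fin (d (out i))) (Fin (d (inp i)) × Fin (d (out i))) ℂ,
    (∀ i, IsChannel (M i)) → (W.transpose * localOp M).trace = 1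

/-- The set `Free` of non-signalling processes: `W = ρ ⊗ 𝟙` with `ρ` a quantum state on all the
input legs and `𝟙` the identity on all the output legs. -/
def IsFree {N : ℕ} {d : Leg N → ℕ} (W : Op d) : Prop :=
  ∃ ρ : Op (fun i : Fin N => d (inp i)), ρ.PosSemidef ∧ ρ.trace = 1 ∧
    ∀ x y, W x y = ρ (fun i => x (inp i)) (fun i => y (inp i)) *
      (1 : Op (fun i : Fin N => d (out i))) (fun i => x (out i)) (fun i => y (out i))

/-- All legs of the parties that come after party `k`. -/
def laterLegs {N : ℕ} (k : Fin N) : Finset (Leg N) :=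
  Finset.univ.filter fun l => k < party l

/-- Causally ordered processes (combs) with order `X^(1) ≺ ⋯ ≺ X^(N)`: `W ≥ 0`, the hierarchy of
trace conditions, and `tr W = ∏ d_O`. The condition for party `k` says that once all legs of the
later parties are traced out, `W` is of the form `𝟙_{X^(k)_O} ⊗ (rest)`; for the last party it is
`_{X^(N)_O} W = W`. -/
structure IsCausallyOrdered {N : ℕ} {d : Leg N → ℕ} (W : Op d) : Prop where
  posSemidef : W.PosSemidef
  hierarchy : ∀ k : Fin N,
    depolarize (laterLegs k) W = depolarize (insert (out k) (laterLegs k)) W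
  trace_eq : W.trace = ∏ i : Fin N, (d (out i) : ℂ)

/-- Proper processes for which party `k` is a definite last party, `_{X^(k)_O} W = W`: party `k`
cannot signal to any of the others. -/
structure HasLastParty {N : ℕ} {d : Leg N → ℕ} (k : Fin N) (W : Op d) : Prop where
  isProcess : IsProcess W
  last : depolarize {out k} W = W

/-- The noise weights `s ≥ 0` such that mixing `W` with some proper process `T` in the proportion
`1 : s` gives a free process. -/
def robustnessSet {N : ℕ} {d : Leg N → ℕ} (W : Op d) : Set ℝ :=
  {s | 0 ≤ s ∧ ∃ T : Op d, IsProcess T ∧ IsFree ((1 + s)⁻¹ • (W + s • T))}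

/-- The signalling robustness `R_s(W)`. -/
def signallingRobustness {N : ℕ} {d : Leg N → ℕ} (W : Op d) : ℝ :=
  sInf (robustnessSet W)

end ProcMat

end

/-!
Let `D` be the product of the squared output dimensions of the parties that may signal. Completely
depolarizing their outputs turns `W` into a free process `F`. Depolarization has the Kraus operators
`|a⟩⟨b|`, up to normalization, and the diagonal ones `|a⟩⟨a|` sum to the identity, so the operator
Cauchy–Schwarz inequality `(∑ K_i) W (∑ K_i)ᴴ ≤ n ∑ K_i W K_iᴴ` gives `W ≤ D F`. Hence
`T = (D F - W) / (D - 1)` is a process, and mixing it with `W` at weight `D - 1` produces `F`.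

In general, a weight `s` is admissible exactly when `W ≤ (1 + s) F` for some free `F`. The free
processes form a compact set and the Loewner order is closed, so the least admissible weight exists.

A comb is a process because depolarization is self-adjoint for the pairing `tr (Aᵀ B)`: from the
last party backwards, each channel can be replaced by the maximally mixed one without changing the
pairing with `W`.
-/

noncomputable section

namespace ProcMat

open Matrix Function
open scoped MatrixOrder

section MatrixInequalities

variable {m n κ : Type*} [Fintype n] [Fintype κ]

theorem sum_sub_mul_mul_conjTranspose_sub (K : κ → Matrix m n ℂ) (W : Matrix n n ℂ) :
    ∑ i, ∑ j, (K i - K j) * W * (K i - K j)ᴴ =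
      (2 : ℝ) • ((Fintype.card κ : ℝ) • ∑ i, K i * W * (K i)ᴴ -
        (∑ i, K i) * W * (∑ i, K i)ᴴ) := by
  have cross : ∑ i, ∑ j, K i * W * (K j)ᴴ = (∑ i, K i) * W * (∑ i, K i)ᴴ := by
    simp only [conjTranspose_sum, Matrix.sum_mul, Matrix.mul_sum]
    exact Finset.sum_comm
  have cross' : ∑ i, ∑ j, K j * W * (K i)ᴴ = (∑ i, K i) * W * (∑ i, K i)ᴴ := by
    rw [Finset.sum_comm, cross]
  simp only [conjTranspose_sub, Matrix.sub_mul, Matrix.mul_sub, Finset.sum_sub_distrib,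
    Finset.sum_const, Finset.card_univ, ← Finset.smul_sum, cross, cross',
    ← Nat.cast_smul_eq_nsmul ℝ]
  module

theorem sum_mul_mul_conjTranspose_sum_le [Finite m] {W : Matrix n n ℂ} (hW : W.PosSemidef)
    (K : κ → Matrix m n ℂ) :
    (∑ i, K i) * W * (∑ i, K i)ᴴ ≤ (Fintype.card κ : ℝ) • ∑ i, K i * W * (K i)ᴴ := by
  have hdiff : (∑ i, ∑ j, (K i - K j) * W * (K i - K j)ᴴ).PosSemidef :=
    posSemidef_sum _ fun i _ => posSemidef_sum _ fun j _ => hW.mul_mul_conjTranspose_same _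
  rw [sum_sub_mul_mul_conjTranspose_sub] at hdiff
  simpa [Matrix.le_iff] using hdiff.smul (inv_nonneg.2 zero_le_two : (0 : ℝ) ≤ 2⁻¹)

end MatrixInequalities

section Depolarize

variable {ι : Type} {d : ι → ℕ}

theorem prod_dim_ne_zero (hd : ∀ l, 0 < d l) (S : Finset ι) : ∏ l ∈ S, (d l : ℂ) ≠ 0 :=
  Finset.prod_ne_zero_iff.2 fun l _ => Nat.cast_ne_zero.2 (hd l).ne'

theorem restrict_eq_restrict_iff {S : Finset ι} {x y : Idx d} :
    S.restrict x = S.restrict y ↔ ∀ l ∈ S, x l = y l := by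
  simp [funext_iff]

variable [DecidableEq ι]

theorem card_idx_coe (S : Finset ι) :
    Fintype.card (Idx fun l : S => d l) = ∏ l ∈ S, d l := by
  simpa using Finset.prod_attach S d

-- `overwrite S z x` unfolds to `updateFinset x S z`, which has the library lemmas.
theorem depolarize_apply (S : Finset ι) (W : Op d) (x y : Idx d) :
    depolarize S W x y = if ∀ l ∈ S, x l = y l then
      (∏ l ∈ S, (d l : ℂ))⁻¹ * ∑ z, W (updateFinset x S z) (updateFinset y S z) else 0 :=
  rfl

theorem depolarize_apply_updateFinset {S : Finset ι} {x y : Idx d} (hxy : ∀ l ∈ S, x l = y l)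
    (W : Op d) (z : Idx fun l : S => d l) :
    depolarize S W (updateFinset x S z) (updateFinset y S z) = depolarize S W x y := by
  have agree_upd : ∀ l ∈ S, updateFinset x S z l = updateFinset y S z l := by
    simp +contextual [updateFinset]
  simp only [depolarize_apply, if_pos hxy, if_pos agree_upd,
    updateFinset_updateFinset_of_subset subset_rfl]

theorem depolarize_eq_self_iff (hd : ∀ l, 0 < d l) {S : Finset ι} {W : Op d} :
    depolarize S W = W ↔ ∀ x y : Idx d, if ∀ l ∈ S, x l = y l then
      ∀ z, W (updateFinset x S z) (updateFinset y S z) = W x y else W x y = 0 := by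
  refine ⟨fun hW x y => ?_, fun hW => ?_⟩
  · split_ifs with hxy
    · intro z
      rw [← hW, depolarize_apply_updateFinset hxy]
    · rw [← hW, depolarize_apply, if_neg hxy]
  · ext x y
    have hWxy := hW x y
    rw [depolarize_apply]
    split_ifs at hWxy ⊢ with hxy
    · rw [Finset.sum_congr rfl fun z _ => hWxy z, Finset.sum_const, Finset.card_univ, card_idx_coe,
        nsmul_eq_mul, Nat.cast_prod, inv_mul_cancel_left₀ (prod_dim_ne_zero hd S)]
    · exact hWxy.symm

theorem depolarize_depolarize_self (hd : ∀ l, 0 < d l) (S : Finset ι) (W : Op d) :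
    depolarize S (depolarize S W) = depolarize S W := by
  refine (depolarize_eq_self_iff hd).2 fun x y => ?_
  split_ifs with hxy
  · exact depolarize_apply_updateFinset hxy W
  · exact if_neg hxy

theorem depolarize_empty (W : Op d) : depolarize ∅ W = W := by
  ext x y
  simp [depolarize_apply]

theorem depolarize_singleton_apply (l : ι) (W : Op d) (x y : Idx d) :
    depolarize {l} W x y =
      if x l = y l then (d l : ℂ)⁻¹ * ∑ m, W (update x l m) (update y l m) else 0 := by
  have sum_eq : ∑ z : (j : ({l} : Finset ι)) → Fin (d j),
      W (updateFinset x {l} z) (updateFinset y {l} z) = ∑ m, W (update x l m) (update y l m) := by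
    simp only [updateFinset_singleton]
    exact Fintype.sum_equiv (Equiv.piUnique fun j : ({l} : Finset ι) => Fin (d j)) _ _ fun _ => rfl
  simp only [depolarize_apply, Finset.mem_singleton, forall_eq, Finset.prod_singleton, sum_eq]

theorem depolarize_depolarize_of_disjoint {S T : Finset ι} (hST : Disjoint S T) (W : Op d) :
    depolarize S (depolarize T W) = depolarize (S ∪ T) W := by
  ext x y
  have agree_iff (z) : (∀ l ∈ T, updateFinset x S z l = updateFinset y S z l) ↔
      ∀ l ∈ T, x l = y l := by
    refine forall₂_congr fun l hl => ?_
    simp [updateFinset, Finset.disjoint_right.1 hST hl]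
  simp only [depolarize_apply, agree_iff, updateFinset_updateFinset hST, Finset.prod_union hST,
    Finset.forall_mem_union]
  by_cases hS : ∀ l ∈ S, x l = y l
  · by_cases hT : ∀ l ∈ T, x l = y l
    · simp only [if_pos hS, if_pos hT, if_pos (And.intro hS hT), ← Finset.mul_sum, mul_inv,
        mul_assoc]
      congr 2
      exact (Fintype.sum_prod_type _).symm.trans <|
        (Equiv.piFinsetUnion (fun l => Fin (d l)) hST).sum_comp fun z =>
          W (updateFinset x (S ∪ T) z) (updateFinset y (S ∪ T) z)
    · simp [hT]
  · simp [hS]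

theorem depolarize_insert {S : Finset ι} {l : ι} (hl : l ∉ S) (W : Op d) :
    depolarize (insert l S) W = depolarize {l} (depolarize S W) := by
  rw [depolarize_depolarize_of_disjoint (Finset.disjoint_singleton_left.2 hl), Finset.insert_eq]

theorem depolarize_eq_self_of_forall_singleton {S : Finset ι} {W : Op d}
    (hW : ∀ l ∈ S, depolarize {l} W = W) : depolarize S W = W := by
  induction S using Finset.induction_on with
  | empty => exact depolarize_empty W
  | insert l S hl ih =>
    rw [depolarize_insert hl, ih fun j hj => hW j (Finset.mem_insert_of_mem hj),
      hW l (Finset.mem_insert_self l S)]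

theorem continuous_depolarize (S : Finset ι) : Continuous (depolarize S : Op d → Op d) := by
  refine continuous_matrix fun x y => ?_
  simp only [depolarize_apply]
  split_ifs <;> fun_prop

section Fintype

variable [Fintype ι]

/-- The operator `|a⟩⟨b|` on the legs in `S`, tensored with the identity on the other legs: up to
normalization, the Kraus operators of `depolarize S`. -/
def localUnit (S : Finset ι) (a b : Idx fun l : S => d l) : Op d :=
  Matrix.of fun x y => if S.restrict x = a ∧ y = updateFinset x S b then 1 else 0

theorem localUnit_apply (S : Finset ι) (a b : Idx fun l : S => d l) (x y : Idx d) :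
    localUnit S a b x y = if S.restrict x = a ∧ y = updateFinset x S b then 1 else 0 :=
  rfl

theorem conjTranspose_localUnit (S : Finset ι) (a b : Idx fun l : S => d l) :
    (localUnit S a b)ᴴ = localUnit S b a := by
  have imp (a b : Idx fun l : S => d l) (x y : Idx d)
      (h : S.restrict y = a ∧ x = updateFinset y S b) :
      S.restrict x = b ∧ y = updateFinset x S a := by
    obtain ⟨rfl, rfl⟩ := h
    simp [restrict_updateFinset, updateFinset_updateFinset_of_subset]
  ext x y
  simp only [conjTranspose_apply, localUnit_apply, apply_ite star, star_one, star_zero,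
    show _ ↔ _ from ⟨imp a b x y, imp b a y x⟩]

theorem sum_localUnit_self (S : Finset ι) : ∑ a, localUnit S a a = (1 : Op d) := by
  ext x y
  simp [Matrix.sum_apply, localUnit_apply, ite_and, Matrix.one_apply, eq_comm]

theorem localUnit_mul_mul_conjTranspose_apply (S : Finset ι) (a b : Idx fun l : S => d l)
    (W : Op d) (x y : Idx d) :
    (localUnit S a b * W * (localUnit S a b)ᴴ) x y =
      if S.restrict x = a ∧ S.restrict y = a then
        W (updateFinset x S b) (updateFinset y S b) else 0 := by
  simp only [mul_apply, conjTranspose_apply, localUnit_apply]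
  by_cases hx : S.restrict x = a <;> by_cases hy : S.restrict y = a <;> simp [hx, hy]

theorem depolarize_eq_sum_localUnit (S : Finset ι) (W : Op d) :
    depolarize S W = (∏ l ∈ S, (d l : ℝ))⁻¹ •
      ∑ a, ∑ b, localUnit S a b * W * (localUnit S a b)ᴴ := by
  ext x y
  simp only [depolarize_apply, Matrix.smul_apply, Matrix.sum_apply,
    localUnit_mul_mul_conjTranspose_apply, ← restrict_eq_restrict_iff, ite_and]
  by_cases hxy : S.restrict x = S.restrict y
  · simp [hxy]
  · simp [hxy, eq_comm]

theorem transpose_localUnit (S : Finset ι) (a b : Idx fun l : S => d l) :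
    (localUnit S a b)ᵀ = localUnit S b a := by
  rw [← conjTranspose_localUnit]
  ext x y
  simp [localUnit_apply, apply_ite star]

theorem trace_transpose_depolarize_mul (S : Finset ι) (A B : Op d) :
    ((depolarize S A)ᵀ * B).trace = (Aᵀ * depolarize S B).trace := by
  have conj_adjoint (a b : Idx fun l : S => d l) :
      ((localUnit S a b * A * (localUnit S a b)ᴴ)ᵀ * B).trace =
        (Aᵀ * (localUnit S b a * B * (localUnit S b a)ᴴ)).trace := by
    simp only [transpose_mul, conjTranspose_localUnit, transpose_localUnit, Matrix.mul_assoc]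
    rw [trace_mul_comm]
    simp only [Matrix.mul_assoc]
  simp only [depolarize_eq_sum_localUnit, transpose_smul, transpose_sum, Matrix.smul_mul,
    Matrix.mul_smul, Matrix.sum_mul, Matrix.mul_sum, trace_smul, trace_sum, conj_adjoint]
  rw [Finset.sum_comm]

theorem depolarize_one (hd : ∀ l, 0 < d l) (S : Finset ι) : depolarize S (1 : Op d) = 1 := by
  refine (depolarize_eq_self_iff hd).2 fun x y => ?_
  split_ifs with hxy
  · intro z
    have upd_eq_iff : updateFinset x S z = updateFinset y S z ↔ x = y := by
      refine ⟨fun h => funext fun l => ?_, fun h => h ▸ rfl⟩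
      by_cases hl : l ∈ S
      · exact hxy l hl
      · simpa [updateFinset, hl] using congrFun h l
    simp only [one_apply, upd_eq_iff]
  · exact one_apply_ne fun h => hxy fun l _ => congrFun h l

theorem trace_depolarize (hd : ∀ l, 0 < d l) (S : Finset ι) (W : Op d) :
    (depolarize S W).trace = W.trace := by
  simpa [depolarize_one hd] using trace_transpose_depolarize_mul S W 1

theorem depolarize_univ (W : Op d) :
    depolarize Finset.univ W = ((∏ l, (d l : ℂ))⁻¹ * W.trace) • 1 := by
  ext x y
  let e : (Idx fun l : (Finset.univ : Finset ι) => d l) ≃ Idx d :=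
    ⟨fun z l => z ⟨l, Finset.mem_univ l⟩, Finset.univ.restrict, fun _ => rfl, fun _ => rfl⟩
  have sum_eq : ∑ z, W (updateFinset x Finset.univ z) (updateFinset y Finset.univ z) = W.trace :=
    Fintype.sum_equiv e _ _ fun z => by simp only [updateFinset_univ]; rfl
  simp [depolarize_apply, sum_eq, one_apply, funext_iff]

end Fintype

variable [Finite ι]

theorem posSemidef_depolarize {W : Op d} (hW : W.PosSemidef) (S : Finset ι) :
    (depolarize S W).PosSemidef := by
  cases nonempty_fintype ι
  rw [depolarize_eq_sum_localUnit]
  exact (posSemidef_sum _ fun a _ => posSemidef_sum _ fun b _ =>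
    hW.mul_mul_conjTranspose_same _).smul (by positivity)

theorem le_smul_depolarize (hd : ∀ l, 0 < d l) {W : Op d} (hW : W.PosSemidef) (S : Finset ι) :
    W ≤ (∏ l ∈ S, (d l : ℝ) ^ 2) • depolarize S W := by
  cases nonempty_fintype ι
  have hterm (a b : Idx fun l : S => d l) :
      0 ≤ localUnit S a b * W * (localUnit S a b)ᴴ :=
    (hW.mul_mul_conjTranspose_same _).nonneg
  calc W = (∑ a, localUnit S a a) * W * (∑ a, localUnit S a a)ᴴ := by simp [sum_localUnit_self]
    _ ≤ (∏ l ∈ S, (d l : ℝ)) • ∑ a, localUnit S a a * W * (localUnit S a a)ᴴ := by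
      simpa only [card_idx_coe, Nat.cast_prod] using
        sum_mul_mul_conjTranspose_sum_le hW fun a => localUnit S a a
    _ ≤ (∏ l ∈ S, (d l : ℝ)) • ∑ a, ∑ b, localUnit S a b * W * (localUnit S a b)ᴴ := by
      gcongr with a
      exact Finset.single_le_sum (fun b _ => hterm a b) (Finset.mem_univ a)
    _ = (∏ l ∈ S, (d l : ℝ) ^ 2) • depolarize S W := by
      have hD : ∏ l ∈ S, (d l : ℝ) ≠ 0 :=
        Finset.prod_ne_zero_iff.2 fun l _ => Nat.cast_ne_zero.2 (hd l).ne'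
      rw [depolarize_eq_sum_localUnit, smul_smul, Finset.prod_pow, sq, mul_inv_cancel_right₀ hD]

end Depolarize

section LocalOperators

/-- The Choi matrix of the channel that discards its input and outputs the maximally mixed state.
Depolarizing the output leg of a party replaces its channel by this one. -/
def mixed (a b : ℕ) : Matrix (Fin a × Fin b) (Fin a × Fin b) ℂ :=
  (b : ℂ)⁻¹ • 1

theorem mixed_apply {a b : ℕ} (p q : Fin a × Fin b) :
    mixed a b p q = if p = q then (b : ℂ)⁻¹ else 0 := by
  simp [mixed, one_apply]

theorem isChannel_mixed {a b : ℕ} (hb : 0 < b) : IsChannel (mixed a b) where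
  posSemidef := PosSemidef.one.smul (by positivity)
  tracePreserving k k' := by
    simp [mixed_apply, one_apply, Nat.cast_ne_zero.2 hb.ne']

variable {N : ℕ} {d : Leg N → ℕ}
  {M : (i : Fin N) →
    Matrix (Fin (d (inp i)) × Fin (d (out i))) (Fin (d (inp i)) × Fin (d (out i))) ℂ}

theorem localOp_mixed :
    localOp (fun i => mixed (d (inp i)) (d (out i))) = (∏ i, (d (out i) : ℂ))⁻¹ • 1 := by
  ext x y
  have eq_iff : (∀ i, x (inp i) = y (inp i) ∧ x (out i) = y (out i)) ↔ x = y := by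
    simp [funext_iff, forall_and]
  simp only [localOp, of_apply, mixed_apply, Prod.mk.injEq, Fintype.prod_ite_zero, eq_iff,
    Finset.prod_inv_distrib, Matrix.smul_apply, one_apply, smul_eq_mul, mul_ite, mul_one, mul_zero]

theorem localOp_apply_eq_mul_prod_compl (k : Fin N) (x y : Idx d) :
    localOp M x y = M k (x (inp k), x (out k)) (y (inp k), y (out k)) *
      ∏ i ∈ {k}ᶜ, M i (x (inp i), x (out i)) (y (inp i), y (out i)) :=
  Fintype.prod_eq_mul_prod_compl k _

theorem depolarize_out_localOp {k : Fin N} (hM : IsChannel (M k)) :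
    depolarize {out k} (localOp M) = localOp (update M k (mixed _ _)) := by
  ext x y
  have prod_update_eq : ∏ i ∈ {k}ᶜ, update M k (mixed _ _) i (x (inp i), x (out i))
      (y (inp i), y (out i)) = ∏ i ∈ {k}ᶜ, M i (x (inp i), x (out i)) (y (inp i), y (out i)) :=
    Finset.prod_congr rfl fun i hi => by
      rw [update_of_ne (by simpa using hi)]
  have localOp_update (m : Fin (d (out k))) :
      localOp M (update x (out k) m) (update y (out k) m) =
        M k (x (inp k), m) (y (inp k), m) *
          ∏ i ∈ {k}ᶜ, M i (x (inp i), x (out i)) (y (inp i), y (out i)) := by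
    rw [localOp_apply_eq_mul_prod_compl k]
    congr 1
    · simp
    · refine Finset.prod_congr rfl fun i hi => ?_
      have hik : out i ≠ out k := by simpa using hi
      simp [update_of_ne hik]
  simp only [depolarize_singleton_apply, localOp_update, ← Finset.sum_mul, hM.tracePreserving]
  rw [localOp_apply_eq_mul_prod_compl k, prod_update_eq, update_self, mixed_apply]
  by_cases hout : x (out k) = y (out k) <;> by_cases hinp : x (inp k) = y (inp k) <;>
    simp [hout, hinp, one_apply, mul_comm]

theorem depolarize_inp_localOp (hd : ∀ l, 0 < d l) {k : Fin N} (hM : M k = mixed _ _) :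
    depolarize {inp k} (localOp M) = localOp M := by
  ext x y
  have localOp_update (hxy : x (inp k) = y (inp k)) (m : Fin (d (inp k))) :
      localOp M (update x (inp k) m) (update y (inp k) m) = localOp M x y := by
    rw [localOp_apply_eq_mul_prod_compl k, localOp_apply_eq_mul_prod_compl k x y]
    congr 1
    · simp [hM, mixed_apply, hxy]
    · refine Finset.prod_congr rfl fun i hi => ?_
      have hik : inp i ≠ inp k := by simpa using hi
      simp [update_of_ne hik]
  rw [depolarize_singleton_apply]
  split_ifs with hxy
  · simp [localOp_update hxy, (hd (inp k)).ne']
  · simp [localOp_apply_eq_mul_prod_compl k, hM, mixed_apply, hxy]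

theorem depolarize_localOp_of_forall_mixed (hd : ∀ l, 0 < d l) {S : Finset (Leg N)}
    (hM : ∀ l ∈ S, M (party l) = mixed _ _) : depolarize S (localOp M) = localOp M := by
  refine depolarize_eq_self_of_forall_singleton fun l hl => ?_
  rcases l with k | k
  · exact depolarize_inp_localOp hd (hM _ hl)
  · have hk : M k = mixed _ _ := hM _ hl
    rw [depolarize_out_localOp (hk ▸ isChannel_mixed (hd _)), ← hk, update_eq_self]

/-- The output legs of the parties in `K`. Invariance under `depolarize (outLegs K)` says that these
parties cannot signal. -/
def outLegs (K : Finset (Fin N)) : Finset (Leg N) :=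
  K.map Embedding.inr

theorem depolarize_outLegs_localOp {K : Finset (Fin N)} (hM : ∀ i ∈ K, IsChannel (M i)) :
    depolarize (outLegs K) (localOp M) = localOp (K.piecewise (fun _ => mixed _ _) M) := by
  induction K using Finset.induction_on with
  | empty => simp [outLegs, depolarize_empty]
  | insert k K hk ih =>
    have hMk : IsChannel (K.piecewise (fun _ => mixed _ _) M k) := by
      simpa [hk] using hM k (Finset.mem_insert_self k K)
    rw [outLegs, Finset.map_insert, depolarize_insert (by simpa using hk), ← outLegs,
      ih fun i hi => hM i (Finset.mem_insert_of_mem hi), Embedding.inr_apply,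
      depolarize_out_localOp hMk, Finset.piecewise_insert]

theorem trace_transpose_mul_localOp_mixed (W : Op d) :
    (Wᵀ * localOp fun i => mixed (d (inp i)) (d (out i))).trace =
      (∏ i, (d (out i) : ℂ))⁻¹ * W.trace := by
  simp [localOp_mixed]

theorem IsProcess.trace_eq (hd : ∀ l, 0 < d l) {W : Op d} (hW : IsProcess W) :
    W.trace = ∏ i, (d (out i) : ℂ) := by
  have htr := hW.normalized _ fun i => isChannel_mixed (hd (out i))
  rw [trace_transpose_mul_localOp_mixed] at htr
  exact (inv_mul_eq_one₀ (prod_dim_ne_zero (fun i => hd (out i)) _)).1 htr |>.symm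

end LocalOperators

section CausalOrder

variable {N : ℕ} {d : Leg N → ℕ} {W : Op d}
  {M : (i : Fin N) →
    Matrix (Fin (d (inp i)) × Fin (d (out i))) (Fin (d (inp i)) × Fin (d (out i))) ℂ}

theorem IsCausallyOrdered.trace_transpose_mul_localOp_update (hd : ∀ l, 0 < d l)
    (hW : IsCausallyOrdered W) {k : Fin N} (hMk : IsChannel (M k))
    (hM : ∀ i, k < i → M i = mixed _ _) :
    (Wᵀ * localOp (update M k (mixed _ _))).trace = (Wᵀ * localOp M).trace := by
  have later_invariant : depolarize (laterLegs k) (localOp M) = localOp M :=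
    depolarize_localOp_of_forall_mixed hd fun l hl => hM _ (by simpa [laterLegs] using hl)
  have out_notMem : out k ∉ laterLegs k := fun h => lt_irrefl k (Finset.mem_filter.1 h).2
  calc (Wᵀ * localOp (update M k (mixed _ _))).trace
      = (Wᵀ * depolarize (insert (out k) (laterLegs k)) (localOp M)).trace := by
        rw [depolarize_insert out_notMem, later_invariant, depolarize_out_localOp hMk]
    _ = ((depolarize (laterLegs k) W)ᵀ * localOp M).trace := by
        rw [← trace_transpose_depolarize_mul, ← hW.hierarchy k]
    _ = (Wᵀ * localOp M).trace := by
        rw [trace_transpose_depolarize_mul, later_invariant]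

theorem IsCausallyOrdered.isProcess (hd : ∀ l, 0 < d l) (hW : IsCausallyOrdered W) :
    IsProcess W := by
  refine ⟨hW.posSemidef, fun M hM => ?_⟩
  have mixed_from (j : ℕ) (hj : j ≤ N) :
      (Wᵀ * localOp fun i => if j ≤ i then mixed (d (inp i)) (d (out i)) else M i).trace = 1 := by
    induction j with
    | zero =>
      have hD : ∏ i, (d (out i) : ℂ) ≠ 0 := prod_dim_ne_zero (fun i => hd (out i)) _
      simp [trace_transpose_mul_localOp_mixed, hW.trace_eq, hD]
    | succ j ih =>
      rw [← ih (by omega), ← hW.trace_transpose_mul_localOp_update hd (k := ⟨j, hj⟩)]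
      · congr 3
        ext i : 1
        rcases eq_or_ne i ⟨j, hj⟩ with rfl | hij
        · simp
        · have hij' : (i : ℕ) ≠ j := fun h => hij (Fin.ext h)
          simp only [update_of_ne hij, show j + 1 ≤ (i : ℕ) ↔ j ≤ i by omega]
      · simpa using hM _
      · intro i hi
        exact if_pos hi
  simpa [not_le.2 (Fin.is_lt _)] using mixed_from N le_rfl

theorem IsCausallyOrdered.hasLastParty {n : ℕ} {d : Leg (n + 1) → ℕ} (hd : ∀ l, 0 < d l)
    {W : Op d} (hW : IsCausallyOrdered W) : HasLastParty (Fin.last n) W where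
  isProcess := hW.isProcess hd
  last := by
    have no_later : laterLegs (Fin.last n) = ∅ := by
      simp [laterLegs, Fin.le_last]
    simpa [no_later, depolarize_empty] using (hW.hierarchy (Fin.last n)).symm

end CausalOrder

section Free

open scoped Kronecker

variable {N : ℕ} {d : Leg N → ℕ}

/-- The operator `ρ ⊗ 𝟙`, with `ρ` on the input legs and `𝟙` on the output legs, as in the
definition of `IsFree`. -/
def tensorOne (ρ : Op fun i : Fin N => d (inp i)) : Op d :=
  (ρ ⊗ₖ (1 : Op fun i : Fin N => d (out i))).submatrix
    (Equiv.sumPiEquivProdPi fun l => Fin (d l)) (Equiv.sumPiEquivProdPi fun l => Fin (d l))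

theorem tensorOne_apply (ρ : Op fun i : Fin N => d (inp i)) (x y : Idx d) :
    tensorOne ρ x y = ρ (fun i => x (inp i)) (fun i => y (inp i)) *
      (1 : Op fun i : Fin N => d (out i)) (fun i => x (out i)) (fun i => y (out i)) :=
  rfl

theorem trace_tensorOne (ρ : Op fun i : Fin N => d (inp i)) :
    (tensorOne ρ : Op d).trace = ρ.trace * ∏ i, (d (out i) : ℂ) := by
  have htr : (tensorOne ρ : Op d).trace = (ρ ⊗ₖ (1 : Op fun i : Fin N => d (out i))).trace :=
    (Equiv.sumPiEquivProdPi fun l => Fin (d l)).sum_comp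
      fun p => (ρ ⊗ₖ (1 : Op fun i : Fin N => d (out i))) p p
  simp [htr, trace_kronecker]

theorem submatrix_tensorOne (ρ : Op fun i : Fin N => d (inp i)) (o : Idx fun i => d (out i)) :
    (tensorOne ρ : Op d).submatrix
      (fun a => (Equiv.sumPiEquivProdPi fun l => Fin (d l)).symm (a, o))
      (fun a => (Equiv.sumPiEquivProdPi fun l => Fin (d l)).symm (a, o)) = ρ := by
  ext a b
  simp [tensorOne]

theorem posSemidef_tensorOne_iff (hd : ∀ l, 0 < d l) {ρ : Op fun i : Fin N => d (inp i)} :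
    (tensorOne ρ : Op d).PosSemidef ↔ ρ.PosSemidef := by
  refine ⟨fun h => ?_, fun h => (h.kronecker PosSemidef.one).submatrix _⟩
  rw [← submatrix_tensorOne ρ fun i => ⟨0, hd (out i)⟩]
  exact h.submatrix _

theorem forall_mem_outLegs_univ_iff {x y : Idx d} :
    (∀ l ∈ outLegs Finset.univ, x l = y l) ↔ (fun i => x (out i)) = fun i => y (out i) := by
  simp [outLegs, funext_iff]

theorem depolarize_outLegs_univ_eq_self_iff (hd : ∀ l, 0 < d l) {V : Op d} :
    depolarize (outLegs Finset.univ) V = V ↔ ∃ ρ, V = tensorOne ρ := by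
  rw [depolarize_eq_self_iff hd]
  simp only [forall_mem_outLegs_univ_iff]
  constructor
  · intro hV
    let e := Equiv.sumPiEquivProdPi fun l => Fin (d l)
    let o : Idx fun i => d (out i) := fun i => ⟨0, hd (out i)⟩
    refine ⟨V.submatrix (fun a => e.symm (a, o)) fun a => e.symm (a, o), ?_⟩
    ext x y
    have hVxy := hV x y
    rw [tensorOne_apply, one_apply]
    split_ifs at hVxy ⊢ with hxy
    · have upd (w : Idx d) :
          updateFinset w (outLegs Finset.univ) (Finset.restrict _ (e.symm ((e x).1, o))) =
            e.symm ((e w).1, o) := by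
        funext l
        cases l <;> simp [updateFinset, outLegs, e]
      have hVo := hVxy (Finset.restrict _ (e.symm ((e x).1, o)))
      rw [upd, upd] at hVo
      rw [mul_one]
      exact hVo.symm
    · simpa using hVxy
  · rintro ⟨ρ, rfl⟩ x y
    split_ifs with hxy
    · intro z
      have agree_upd :
          (fun i => updateFinset x _ z (out i)) = fun i => updateFinset y _ z (out i) :=
        forall_mem_outLegs_univ_iff.1 <| by simp +contextual [updateFinset]
      have inp_upd (w : Idx d) (i : Fin N) : updateFinset w _ z (inp i) = w (inp i) := by
        simp [updateFinset, outLegs]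
      rw [tensorOne_apply, tensorOne_apply, one_apply, one_apply, if_pos agree_upd, if_pos hxy]
      simp only [inp_upd]
    · simp [tensorOne_apply, one_apply_ne hxy]

theorem isFree_iff (hd : ∀ l, 0 < d l) {V : Op d} :
    IsFree V ↔ V.PosSemidef ∧ depolarize (outLegs Finset.univ) V = V ∧
      V.trace = ∏ i, (d (out i) : ℂ) := by
  have trace_iff (ρ : Op fun i : Fin N => d (inp i)) :
      (tensorOne ρ : Op d).trace = ∏ i, (d (out i) : ℂ) ↔ ρ.trace = 1 := by
    rw [trace_tensorOne, mul_eq_right₀ (prod_dim_ne_zero (fun i => hd (out i)) _)]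
  rw [depolarize_outLegs_univ_eq_self_iff hd]
  constructor
  · rintro ⟨ρ, hρ, htr, hV⟩
    obtain rfl : V = tensorOne ρ := Matrix.ext hV
    exact ⟨(posSemidef_tensorOne_iff hd).2 hρ, ⟨ρ, rfl⟩, (trace_iff ρ).2 htr⟩
  · rintro ⟨hV, ⟨ρ, rfl⟩, htr⟩
    exact ⟨ρ, (posSemidef_tensorOne_iff hd).1 hV, (trace_iff ρ).1 htr, tensorOne_apply ρ⟩

theorem IsFree.isProcess (hd : ∀ l, 0 < d l) {V : Op d} (hV : IsFree V) : IsProcess V := by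
  obtain ⟨hpos, hdep, htr⟩ := (isFree_iff hd).1 hV
  refine ⟨hpos, fun M hM => ?_⟩
  calc (Vᵀ * localOp M).trace
      = (Vᵀ * depolarize (outLegs Finset.univ) (localOp M)).trace := by
        rw [← trace_transpose_depolarize_mul, hdep]
    _ = (Vᵀ * localOp fun i => mixed (d (inp i)) (d (out i))).trace := by
        rw [depolarize_outLegs_localOp fun i _ => hM i, Finset.piecewise_univ]
    _ = 1 := by
        rw [trace_transpose_mul_localOp_mixed, htr,
          inv_mul_cancel₀ (prod_dim_ne_zero (fun i => hd (out i)) _)]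

theorem IsProcess.isFree_depolarize (hd : ∀ l, 0 < d l) {W : Op d} (hW : IsProcess W) :
    IsFree (depolarize (outLegs Finset.univ) W) :=
  (isFree_iff hd).2 ⟨posSemidef_depolarize hW.posSemidef _, depolarize_depolarize_self hd _ W,
    (trace_depolarize hd _ W).trans (hW.trace_eq hd)⟩

end Free

section LoewnerTopology

theorem compactIccSpace_of_finiteDimensional {A : Type*} [NonUnitalCStarAlgebra A]
    [PartialOrder A] [StarOrderedRing A] [FiniteDimensional ℂ A] : CompactIccSpace A where
  isCompact_Icc {a b} := by
    have : ProperSpace A := FiniteDimensional.proper ℂ A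
    refine Metric.isCompact_of_isClosed_isBounded isClosed_Icc <|
      isBounded_iff_forall_norm_le.2 ⟨‖a‖ + ‖b - a‖, fun x hx => ?_⟩
    calc ‖x‖ = ‖a + (x - a)‖ := by rw [add_sub_cancel]
      _ ≤ ‖a‖ + ‖x - a‖ := norm_add_le _ _
      _ ≤ ‖a‖ + ‖b - a‖ := by
        gcongr
        exact CStarAlgebra.norm_le_norm_of_nonneg_of_le (sub_nonneg.2 hx.1)
          (sub_le_sub_right hx.2 a)

variable {n : Type*} [Finite n]

-- The L2 operator norm makes matrices a C⋆-algebra without changing their entrywise topology.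
open scoped Matrix.Norms.L2Operator in
instance : OrderClosedTopology (Matrix n n ℂ) := by
  classical
  cases nonempty_fintype n
  infer_instance

open scoped Matrix.Norms.L2Operator in
instance : CompactIccSpace (Matrix n n ℂ) := by
  classical
  cases nonempty_fintype n
  exact compactIccSpace_of_finiteDimensional

end LoewnerTopology

section Robustness

variable {N : ℕ} {d : Leg N → ℕ}

theorem isClosed_setOf_isFree (hd : ∀ l, 0 < d l) : IsClosed {F : Op d | IsFree F} := by
  simp only [isFree_iff hd, ← nonneg_iff_posSemidef, Set.ofPred_and]
  exact isClosed_Ici.inter <| (isClosed_eq (continuous_depolarize _) continuous_id).inter <|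
    isClosed_eq (by fun_prop) continuous_const

theorem isCompact_setOf_isFree (hd : ∀ l, 0 < d l) : IsCompact {F : Op d | IsFree F} := by
  refine (isCompact_Icc (a := 0) (b := (∏ l, (d l : ℝ) ^ 2) •
    ((∏ l, (d l : ℂ))⁻¹ * ∏ i, (d (out i) : ℂ)) • (1 : Op d))).of_isClosed_subset
      (isClosed_setOf_isFree hd) fun F hF => ?_
  obtain ⟨hpos, -, htr⟩ := (isFree_iff hd).1 hF
  have hle := le_smul_depolarize hd hpos Finset.univ
  rw [depolarize_univ, htr] at hle
  exact ⟨hpos.nonneg, hle⟩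

theorem mem_robustnessSet_iff (hd : ∀ l, 0 < d l) {W : Op d} (hW : IsProcess W) {s : ℝ} :
    s ∈ robustnessSet W ↔ 0 ≤ s ∧ ∃ F, IsFree F ∧ W ≤ (1 + s) • F := by
  refine and_congr_right fun hs => ⟨fun ⟨T, hT, hF⟩ => ⟨_, hF, ?_⟩, fun ⟨F, hF, hle⟩ => ?_⟩
  · rw [smul_inv_smul₀ (by positivity)]
    exact le_add_of_nonneg_right (hT.posSemidef.smul hs).nonneg
  have hFproc := hF.isProcess hd
  rcases hs.eq_or_lt with rfl | hs
  · have hWF : F - W = 0 := by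
      rw [add_zero, one_smul] at hle
      refine (Matrix.le_iff.1 hle).trace_eq_zero_iff.1 ?_
      rw [trace_sub, hFproc.trace_eq hd, hW.trace_eq hd, sub_self]
    obtain rfl : F = W := sub_eq_zero.1 hWF
    exact ⟨F, hW, by simpa using hF⟩
  · refine ⟨s⁻¹ • ((1 + s) • F - W), ⟨?_, fun M hM => ?_⟩, ?_⟩
    · exact (Matrix.le_iff.1 hle).smul (inv_nonneg.2 hs.le)
    · have hsC : (s : ℂ) ≠ 0 := Complex.ofReal_ne_zero.2 hs.ne'
      simp [Matrix.sub_mul, hFproc.normalized M hM, hW.normalized M hM, hsC]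
    · rwa [smul_inv_smul₀ hs.ne', add_sub_cancel, inv_smul_smul₀ (by positivity)]

theorem isLeast_signallingRobustness (hd : ∀ l, 0 < d l) {W : Op d} (hW : IsProcess W)
    (hne : (robustnessSet W).Nonempty) : IsLeast (robustnessSet W) (signallingRobustness W) := by
  obtain ⟨s₀, hs₀⟩ := hne
  obtain ⟨hs₀_nonneg, F₀, hF₀, hle₀⟩ := (mem_robustnessSet_iff hd hW).1 hs₀
  have hcompact : IsCompact ((Set.Icc 0 s₀ ×ˢ {F : Op d | IsFree F}) ∩
      {p | W ≤ (1 + p.1) • p.2}) :=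
    (isCompact_Icc.prod (isCompact_setOf_isFree hd)).inter_right <|
      isClosed_le continuous_const (by fun_prop)
  obtain ⟨⟨s, F⟩, ⟨⟨hs, hF⟩, hle⟩, hmin⟩ := hcompact.exists_isMinOn
    ⟨(s₀, F₀), ⟨⟨Set.right_mem_Icc.2 hs₀_nonneg, hF₀⟩, hle₀⟩⟩ continuous_fst.continuousOn
  have hleast : IsLeast (robustnessSet W) s := by
    refine ⟨(mem_robustnessSet_iff hd hW).2 ⟨hs.1, F, hF, hle⟩, fun t ht => ?_⟩
    obtain ⟨ht_nonneg, F', hF', hle'⟩ := (mem_robustnessSet_iff hd hW).1 ht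
    rcases le_total t s₀ with hts | hst
    · exact hmin (a := (t, F')) ⟨⟨⟨ht_nonneg, hts⟩, hF'⟩, hle'⟩
    · exact hs.2.trans hst
  rwa [signallingRobustness, hleast.csInf_eq]

theorem sub_one_mem_robustnessSet (hd : ∀ l, 0 < d l) {W : Op d} (hW : IsProcess W)
    {K : Finset (Fin N)} (hK : depolarize (outLegs K) W = W) :
    ∏ i ∈ Kᶜ, (d (out i) : ℝ) ^ 2 - 1 ∈ robustnessSet W := by
  have depolarize_univ_eq :
      depolarize (outLegs Finset.univ) W = depolarize (outLegs Kᶜ) W := by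
    have hdisj : Disjoint (outLegs Kᶜ) (outLegs K) :=
      (Finset.disjoint_map _).2 disjoint_compl_left
    conv_rhs => rw [← hK, depolarize_depolarize_of_disjoint hdisj, outLegs, outLegs,
      ← Finset.map_union, Finset.union_comm, Finset.union_compl, ← outLegs]
  have one_le_prod : 1 ≤ ∏ i ∈ Kᶜ, (d (out i) : ℝ) ^ 2 :=
    Finset.one_le_prod fun i _ => one_le_pow₀ (Nat.one_le_cast.2 (hd (out i)))
  refine (mem_robustnessSet_iff hd hW).2 ⟨sub_nonneg.2 one_le_prod,
    depolarize (outLegs Finset.univ) W, hW.isFree_depolarize hd, ?_⟩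
  have hle := le_smul_depolarize hd hW.posSemidef (outLegs Kᶜ)
  rw [add_sub_cancel, depolarize_univ_eq]
  simpa [outLegs] using hle

theorem prod_compl_last {R : Type*} [CommMonoid R] {n : ℕ} (f : Fin (n + 1) → R) :
    ∏ i ∈ {Fin.last n}ᶜ, f i = ∏ i : Fin n, f i.castSucc := by
  simpa [Finset.map_eq_image] using Finset.prod_map Finset.univ Fin.castSuccEmb f

end Robustness

end ProcMat

end

theorem mainTheorem3_general {N : ℕ} {d : ProcMat.Leg N → ℕ} (hd : ∀ l, 0 < d l)
    {W : ProcMat.Op d} (hW : ProcMat.IsProcess W) {K : Finset (Fin N)}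
    (hK : ProcMat.depolarize (ProcMat.outLegs K) W = W) :
    IsLeast (ProcMat.robustnessSet W) (ProcMat.signallingRobustness W) ∧
      ProcMat.signallingRobustness W ≤ ∏ i ∈ Kᶜ, (d (ProcMat.out i) : ℝ) ^ 2 - 1 := by
  have bound_mem := ProcMat.sub_one_mem_robustnessSet hd hW hK
  have hleast := ProcMat.isLeast_signallingRobustness hd hW ⟨_, bound_mem⟩
  exact ⟨hleast, hleast.2 bound_mem⟩

theorem mainTheorem3 (n : ℕ) (d : ProcMat.Leg (n + 1) → ℕ) (hd : ∀ l, 0 < d l) :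
    (∀ W : ProcMat.Op d, ProcMat.IsCausallyOrdered W →
      IsLeast (ProcMat.robustnessSet W) (ProcMat.signallingRobustness W) ∧
      ProcMat.signallingRobustness W
        ≤ (∏ i : Fin n, (d (ProcMat.out i.castSucc) : ℝ) ^ 2) - 1) ∧
    (∀ W : ProcMat.Op d, ProcMat.HasLastParty (Fin.last n) W →
      IsLeast (ProcMat.robustnessSet W) (ProcMat.signallingRobustness W) ∧
      ProcMat.signallingRobustness W
        ≤ (∏ i : Fin n, (d (ProcMat.out i.castSucc) : ℝ) ^ 2) - 1) := by
  have bound (W : ProcMat.Op d) (hW : ProcMat.HasLastParty (Fin.last n) W) := by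
    simpa only [ProcMat.prod_compl_last] using
      mainTheorem3_general hd hW.isProcess (K := {Fin.last n}) hW.last
  exact ⟨fun W hW => bound W (hW.hasLastParty hd), bound⟩
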